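/- Let $n\in\mathbb N$, $a,b\in\mathbb R^n$ and let $Q\in\mathbb R^{n\times n}$ be positive semidefinite. Consider $$(\mathrm{QI})\qquad \min\{a'x+b'y+y'Qy:\ (x,y)\in\mathcal I_n\},\qquad \mathcal I_n=\{(x,y)\in\{0,1\}^n\times\mathbb R_+^n:\ y_i(1-x_i)=0\ \ \forall i\}.$$ Let $\mathcal W$ be the set of points $(x_1,x_2,y_1,y_2,Y_{11},Y_{12},Y_{22})\in\mathbb R^7$ for which there is a symmetric matrix $W\in\mathbb R^{3\times 3}$, $W\succeq 0$, with $W_{12}=Y_{12}$, $W_{33}\ge x_1+x_2-1$ and, for $i=1,2$, $$(Y_{ii}-W_{ii})(x_i-W_{33})\ge (y_i-W_{3i})^2,\quad W_{ii}\le Y_{ii},\quad W_{33}\le x_i,\quad 0\le W_{3i}\le y_i.$$ Let OptPairs be the problem of minimizing $a'x+b'y+\langle Q,Y\rangle$ over all $(x,y,Y)\in\mathbb R^n\times\mathbb R^n\times\mathbb R^{n\times n}$, $Y$ symmetric, with $Y-yy'\succeq 0$, $(x_i,x_j,y_i,y_j,Y_{ii},Y_{ij},Y_{jj})\in\mathcal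 W$ for all $i<j$, $0\le x\le 1$ and $y\ge 0$. For $d\in\mathcal D=\{d\in\mathbb R^2: d_1\ge 0,\ d_2\ge 0,\ d_1d_2\ge 1\}$ let $$f_\pm^*(x_1,x_2,y_1,y_2;d)=\inf_{z,\lambda}\ \frac{d_1(y_1-z_1)^2}{x_1-\lambda}+\frac{d_2(y_2-z_2)^2}{x_2-\lambda}+\frac{d_1z_1^2\pm 2z_1z_2+d_2z_2^2}{\lambda}\in[0,\infty],$$ where $\max\{0,x_1+x_2-1\}\le\lambda\le\min\{x_1,x_2\}$ and $z\in\mathbb R^2$ satisfies $z_1,z_2\ge 0$ for $f_+^*$, and $z_1\le y_1$, $z_2\le y_2$ for $f_-^*$. Here $q/0=\infty$ if $q>0$ and $0/0=0$. Then OptPairs is a valid convex relaxation of (QI): its feasible set and its objective are convex; for every $(x,y)\in\mathcal I_n$ the point $(x,y,yy')$ is feasible for OptPairs and has the same objective value there as $(x,y)$ has in (QI); hence the optimal value (infimum in $[-\infty,\infty]$) of OptPairs is at most that of (QI). Moreover, every feasible solution $(x,y,Y)$ of OptPairs satisfies, for all $i<j$, $$\sup_{d\in\mathcal D}\{f_+^*(x_i,x_j,y_i,y_j;d)-d_1Y_{ii}-d_2Y_{jj}-2Y_{ij}\}\le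 0,\qquad \sup_{d\in\mathcal D}\{f_-^*(x_i,x_j,y_i,y_j;d)-d_1Y_{ii}-d_2Y_{jj}+2Y_{ij}\}\le 0.$$ -/

import Mathlib

open scoped ENNReal

noncomputable section

namespace QI

/-- The indicator set: `(x, y) ∈ {0,1}ⁿ × ℝ₊ⁿ` with `yᵢ (1 - xᵢ) = 0` for all `i`. -/
def indicatorSet (n : ℕ) : Set ((Fin n → ℝ) × (Fin n → ℝ)) :=
  {p | ∀ i, (p.1 i = 0 ∨ p.1 i = 1) ∧ 0 ≤ p.2 i ∧ p.2 i * (1 - p.1 i) = 0}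

/-- The objective `a'x + b'y + y'Qy` of (QI). -/
def objective {n : ℕ} (a b : Fin n → ℝ) (Q : Matrix (Fin n) (Fin n) ℝ)
    (p : (Fin n → ℝ) × (Fin n → ℝ)) : ℝ :=
  a ⬝ᵥ p.1 + b ⬝ᵥ p.2 + p.2 ⬝ᵥ Q.mulVec p.2

/-- The set `𝒲`, as a predicate on `(x₁, x₂, y₁, y₂, Y₁₁, Y₁₂, Y₂₂)`.  The row and column
indices `1, 2, 3` of the matrix `W` are `0, 1, 2` here; `W.PosSemidef` includes the symmetry
of `W`. -/
def InW (x₁ x₂ y₁ y₂ Y₁₁ Y₁₂ Y₂₂ : ℝ) : Prop :=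
  ∃ W : Matrix (Fin 3) (Fin 3) ℝ,
    W 0 1 = Y₁₂ ∧
    ((y₁ - W 2 0) ^ 2 ≤ (Y₁₁ - W 0 0) * (x₁ - W 2 2) ∧ W 0 0 ≤ Y₁₁ ∧ W 2 2 ≤ x₁) ∧
    ((y₂ - W 2 1) ^ 2 ≤ (Y₂₂ - W 1 1) * (x₂ - W 2 2) ∧ W 1 1 ≤ Y₂₂ ∧ W 2 2 ≤ x₂) ∧
    (0 ≤ W 2 0 ∧ W 2 0 ≤ y₁) ∧
    (0 ≤ W 2 1 ∧ W 2 1 ≤ y₂) ∧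
    x₁ + x₂ - 1 ≤ W 2 2 ∧
    W.PosSemidef

/-- The feasible set of OptPairs, consisting of triples `(x, y, Y)`. -/
def optPairsSet (n : ℕ) : Set ((Fin n → ℝ) × (Fin n → ℝ) × Matrix (Fin n) (Fin n) ℝ) :=
  {p | (p.2.2 - Matrix.vecMulVec p.2.1 p.2.1).PosSemidef ∧
    (∀ i j, i < j →
      InW (p.1 i) (p.1 j) (p.2.1 i) (p.2.1 j) (p.2.2 i i) (p.2.2 i j) (p.2.2 j j)) ∧
    ∀ i, 0 ≤ p.1 i ∧ p.1 i ≤ 1 ∧ 0 ≤ p.2.1 i}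

/-- The objective `a'x + b'y + ⟨Q, Y⟩` of OptPairs. -/
def optPairsObjective {n : ℕ} (a b : Fin n → ℝ) (Q : Matrix (Fin n) (Fin n) ℝ)
    (p : (Fin n → ℝ) × (Fin n → ℝ) × Matrix (Fin n) (Fin n) ℝ) : ℝ :=
  a ⬝ᵥ p.1 + b ⬝ᵥ p.2.1 + ∑ i, ∑ j, Q i j * p.2.2 i j

/-- The coefficient set `𝒟 = {d ∈ ℝ² : d₁ ≥ 0, d₂ ≥ 0, d₁ d₂ ≥ 1}`. -/
def coeffSet : Set (ℝ × ℝ) := {d | 0 ≤ d.1 ∧ 0 ≤ d.2 ∧ 1 ≤ d.1 * d.2}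

/-- The quotient `q / r` of nonnegative reals with the convention `q / 0 = ∞` for `q ≠ 0` and
`0 / 0 = 0`.  It is only used for `q ≥ 0` and `r ≥ 0`. -/
def quot (q r : ℝ) : ℝ≥0∞ := ENNReal.ofReal q / ENNReal.ofReal r

/-- The function `f₊*`: the optimal value over `(z, lam)` of the problem that describes the
closed convex hull of `{(x, y, t) : t ≥ d₁ y₁² + 2 y₁ y₂ + d₂ y₂²}` with indicators. -/
def fPlus (x₁ x₂ y₁ y₂ d₁ d₂ : ℝ) : ℝ≥0∞ :=
  ⨅ (z₁ : ℝ) (z₂ : ℝ) (lam : ℝ) (_ : 0 ≤ z₁ ∧ 0 ≤ z₂ ∧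
      max 0 (x₁ + x₂ - 1) ≤ lam ∧ lam ≤ min x₁ x₂),
    quot (d₁ * (y₁ - z₁) ^ 2) (x₁ - lam) + quot (d₂ * (y₂ - z₂) ^ 2) (x₂ - lam) +
      quot (d₁ * z₁ ^ 2 + 2 * z₁ * z₂ + d₂ * z₂ ^ 2) lam

/-- The function `f₋*`: the optimal value over `(z, lam)` of the problem that describes the
closed convex hull of `{(x, y, t) : t ≥ d₁ y₁² - 2 y₁ y₂ + d₂ y₂²}` with indicators. -/
def fMinus (x₁ x₂ y₁ y₂ d₁ d₂ : ℝ) : ℝ≥0∞ :=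
  ⨅ (z₁ : ℝ) (z₂ : ℝ) (lam : ℝ) (_ : z₁ ≤ y₁ ∧ z₂ ≤ y₂ ∧
      max 0 (x₁ + x₂ - 1) ≤ lam ∧ lam ≤ min x₁ x₂),
    quot (d₁ * (y₁ - z₁) ^ 2) (x₁ - lam) + quot (d₂ * (y₂ - z₂) ^ 2) (x₂ - lam) +
      quot (d₁ * z₁ ^ 2 - 2 * z₁ * z₂ + d₂ * z₂ ^ 2) lam

end QI

end

open Matrix

namespace QI

/-! The matrix `W` certifying membership in 𝒲 already supplies a point of the infimum: z = (W₃₁,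
W₃₂), λ = W₃₃. There the first two quotients are at most dᵢ(Yᵢᵢ - Wᵢᵢ) by the cone constraints, and
the third is at most d₁W₁₁ + d₂W₂₂ ± 2W₁₂, by pairing the Schur complement of `W` with the positive
semidefinite matrix [[d₁, ±1], [±1, d₂]] (`pair_form_le_mul`). The bounds add up to d₁Y₁₁ + d₂Y₂₂ ±
2Y₁₂. For the relaxation, certificates combine convexly and x₁x₂(y₁,y₂,1)(y₁,y₂,1)' certifies
indicator points. -/

/-- Convexity of the rotated cone p² ≤ uv; the cross term is AM-GM, from (pq)² ≤ (uz)(wv). -/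
lemma add_sq_le_add_mul_add {p u v q w z t s : ℝ} (hu : 0 ≤ u) (hv : 0 ≤ v) (hw : 0 ≤ w)
    (hz : 0 ≤ z) (ht : 0 ≤ t) (hs : 0 ≤ s) (h₁ : p ^ 2 ≤ u * v) (h₂ : q ^ 2 ≤ w * z) :
    (t * p + s * q) ^ 2 ≤ (t * u + s * w) * (t * v + s * z) := by
  have hpq : 2 * (p * q) ≤ u * z + w * v := by
    apply le_of_sq_le_sq _ (by positivity)
    have := mul_le_mul h₁ h₂ (sq_nonneg q) (mul_nonneg hu hv)
    nlinarith [sq_nonneg (u * z - w * v)]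
  nlinarith [mul_le_mul_of_nonneg_left h₁ (sq_nonneg t),
    mul_le_mul_of_nonneg_left h₂ (sq_nonneg s), mul_le_mul_of_nonneg_left hpq (mul_nonneg ht hs)]

/-- The quadratic form of a positive semidefinite `3 × 3` matrix in terms of its entries. -/
lemma quadForm_fin_three_nonneg {W : Matrix (Fin 3) (Fin 3) ℝ} (hW : W.PosSemidef)
    (r s t : ℝ) :
    0 ≤ W 0 0 * r ^ 2 + W 1 1 * s ^ 2 + W 2 2 * t ^ 2 + 2 * W 0 1 * (r * s) +
      2 * W 2 0 * (r * t) + 2 * W 2 1 * (s * t) := by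
  have h := hW.dotProduct_mulVec_nonneg ![r, s, t]
  have h10 : W 1 0 = W 0 1 := by simpa using hW.isHermitian.apply 0 1
  have h02 : W 0 2 = W 2 0 := by simpa using hW.isHermitian.apply 2 0
  have h12 : W 1 2 = W 2 1 := by simpa using hW.isHermitian.apply 2 1
  simp [dotProduct, mulVec, Fin.sum_univ_three, h10, h02, h12] at h
  linarith

lemma eq_zero_of_quadForm_nonneg {A z : ℝ} (h : ∀ t : ℝ, 0 ≤ A + 2 * z * t) : z = 0 := by
  by_contra hz
  have := h (-(A + 1) / (2 * z))
  rw [mul_div_cancel₀ _ (by simpa using hz)] at this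
  linarith

/-- With D = [[d₁, e], [e, d₂]] and B = [[1, 0, r], [0, 1, s]] this is ⟨D, BWB'⟩. Since e² = 1, d₁D
= (d₁,e)(d₁,e)' + (d₁d₂ - 1)(0,1)(0,1)', so two values of the form of `W` suffice. -/
lemma pair_form_nonneg {W : Matrix (Fin 3) (Fin 3) ℝ} (hW : W.PosSemidef) {d₁ d₂ e : ℝ}
    (hd₁ : 0 ≤ d₁) (hd : 1 ≤ d₁ * d₂) (he : e ^ 2 = 1) (r s : ℝ) :
    0 ≤ d₁ * (W 0 0 + W 2 2 * r ^ 2 + 2 * W 2 0 * r) +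
      d₂ * (W 1 1 + W 2 2 * s ^ 2 + 2 * W 2 1 * s) +
      2 * e * (W 0 1 + W 2 2 * (r * s) + W 2 0 * s + W 2 1 * r) := by
  have hpos : 0 < d₁ := lt_of_le_of_ne hd₁ (by rintro rfl; norm_num at hd)
  have h₁ := quadForm_fin_three_nonneg hW d₁ e (d₁ * r + e * s)
  have h₂ := mul_nonneg (sub_nonneg.2 hd) (quadForm_fin_three_nonneg hW 0 1 s)
  refine nonneg_of_mul_nonneg_right (a := d₁) ?_ hpos
  have h₃ : d₁ * (d₁ * (W 0 0 + W 2 2 * r ^ 2 + 2 * W 2 0 * r) +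
      d₂ * (W 1 1 + W 2 2 * s ^ 2 + 2 * W 2 1 * s) +
      2 * e * (W 0 1 + W 2 2 * (r * s) + W 2 0 * s + W 2 1 * r)) =
      (W 0 0 * d₁ ^ 2 + W 1 1 * e ^ 2 + W 2 2 * (d₁ * r + e * s) ^ 2 + 2 * W 0 1 * (d₁ * e) +
      2 * W 2 0 * (d₁ * (d₁ * r + e * s)) + 2 * W 2 1 * (e * (d₁ * r + e * s))) +
      (d₁ * d₂ - 1) * (W 0 0 * 0 ^ 2 + W 1 1 * 1 ^ 2 + W 2 2 * s ^ 2 + 2 * W 0 1 * (0 * 1) +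
      2 * W 2 0 * (0 * s) + 2 * W 2 1 * (1 * s)) := by
    linear_combination (-W 1 1 - 2 * W 2 1 * s - W 2 2 * s ^ 2) * he
  rw [h₃]
  exact add_nonneg h₁ h₂

/-- A Schur complement inequality, in the form that also covers `W 2 2 = 0`. -/
lemma pair_form_le_mul {W : Matrix (Fin 3) (Fin 3) ℝ} (hW : W.PosSemidef) {d₁ d₂ e : ℝ}
    (hd₁ : 0 ≤ d₁) (hd : 1 ≤ d₁ * d₂) (he : e ^ 2 = 1) :
    d₁ * W 2 0 ^ 2 + 2 * e * (W 2 0 * W 2 1) + d₂ * W 2 1 ^ 2 ≤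
      (d₁ * W 0 0 + d₂ * W 1 1 + 2 * e * W 0 1) * W 2 2 := by
  have h22 : 0 ≤ W 2 2 := hW.diag_nonneg
  rcases h22.eq_or_lt with h0 | hpos
  -- A zero diagonal entry forces its row to vanish: the form is then affine in t and bounded below.
  · have hz₁ : W 2 0 = 0 := eq_zero_of_quadForm_nonneg (A := W 0 0) fun t => by
      have := quadForm_fin_three_nonneg hW 1 0 t
      rw [← h0] at this
      linarith
    have hz₂ : W 2 1 = 0 := eq_zero_of_quadForm_nonneg (A := W 1 1) fun t => by
      have := quadForm_fin_three_nonneg hW 0 1 t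
      rw [← h0] at this
      linarith
    simp [hz₁, hz₂, ← h0]
  -- These r and s complete the square, turning BWB' into the Schur complement of `W 2 2`.
  · have h := mul_nonneg hpos.le
      (pair_form_nonneg hW hd₁ hd he (-W 2 0 / W 2 2) (-W 2 1 / W 2 2))
    field_simp at h
    linarith

lemma quot_le_ofReal {q r c : ℝ} (hr : 0 ≤ r) (h : q ≤ c * r) : quot q r ≤ ENNReal.ofReal c := by
  rcases hr.eq_or_lt with rfl | hr
  · have hq : q ≤ 0 := by simpa using h
    simp [quot, ENNReal.ofReal_of_nonpos hq]
  · rw [quot, ← ENNReal.ofReal_div_of_pos hr]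
    exact ENNReal.ofReal_le_ofReal ((div_le_iff₀ hr).2 h)

lemma quot_add_quot_add_quot_le {x₁ x₂ y₁ y₂ Y₁₁ Y₂₂ d₁ d₂ e : ℝ}
    {W : Matrix (Fin 3) (Fin 3) ℝ} (hW : W.PosSemidef)
    (h₁ : (y₁ - W 2 0) ^ 2 ≤ (Y₁₁ - W 0 0) * (x₁ - W 2 2) ∧ W 0 0 ≤ Y₁₁ ∧ W 2 2 ≤ x₁)
    (h₂ : (y₂ - W 2 1) ^ 2 ≤ (Y₂₂ - W 1 1) * (x₂ - W 2 2) ∧ W 1 1 ≤ Y₂₂ ∧ W 2 2 ≤ x₂)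
    (hd₁ : 0 ≤ d₁) (hd₂ : 0 ≤ d₂) (hd : 1 ≤ d₁ * d₂) (he : e ^ 2 = 1) :
    quot (d₁ * (y₁ - W 2 0) ^ 2) (x₁ - W 2 2) + quot (d₂ * (y₂ - W 2 1) ^ 2) (x₂ - W 2 2) +
      quot (d₁ * W 2 0 ^ 2 + 2 * e * (W 2 0 * W 2 1) + d₂ * W 2 1 ^ 2) (W 2 2) ≤
      ENNReal.ofReal (d₁ * Y₁₁ + d₂ * Y₂₂ + 2 * e * W 0 1) := by
  have hc : 0 ≤ d₁ * W 0 0 + d₂ * W 1 1 + 2 * e * W 0 1 := by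
    simpa using pair_form_nonneg hW hd₁ hd he 0 0
  have hc₁ : 0 ≤ d₁ * (Y₁₁ - W 0 0) := mul_nonneg hd₁ (sub_nonneg.2 h₁.2.1)
  have hc₂ : 0 ≤ d₂ * (Y₂₂ - W 1 1) := mul_nonneg hd₂ (sub_nonneg.2 h₂.2.1)
  have key : d₁ * Y₁₁ + d₂ * Y₂₂ + 2 * e * W 0 1 = d₁ * (Y₁₁ - W 0 0) + d₂ * (Y₂₂ - W 1 1) +
      (d₁ * W 0 0 + d₂ * W 1 1 + 2 * e * W 0 1) := by ring
  rw [key, ENNReal.ofReal_add (add_nonneg hc₁ hc₂) hc, ENNReal.ofReal_add hc₁ hc₂]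
  gcongr
  · refine quot_le_ofReal (sub_nonneg.2 h₁.2.2) ?_
    rw [mul_assoc]
    exact mul_le_mul_of_nonneg_left h₁.1 hd₁
  · refine quot_le_ofReal (sub_nonneg.2 h₂.2.2) ?_
    rw [mul_assoc]
    exact mul_le_mul_of_nonneg_left h₂.1 hd₂
  · exact quot_le_ofReal hW.diag_nonneg (pair_form_le_mul hW hd₁ hd he)

lemma InW.form_nonneg {x₁ x₂ y₁ y₂ Y₁₁ Y₁₂ Y₂₂ d₁ d₂ e : ℝ}
    (h : InW x₁ x₂ y₁ y₂ Y₁₁ Y₁₂ Y₂₂) (hd₁ : 0 ≤ d₁) (hd₂ : 0 ≤ d₂) (hd : 1 ≤ d₁ * d₂)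
    (he : e ^ 2 = 1) : 0 ≤ d₁ * Y₁₁ + d₂ * Y₂₂ + 2 * e * Y₁₂ := by
  obtain ⟨W, rfl, h₁, h₂, -, -, -, hW⟩ := h
  have hc : 0 ≤ d₁ * W 0 0 + d₂ * W 1 1 + 2 * e * W 0 1 := by
    simpa using pair_form_nonneg hW hd₁ hd he 0 0
  have := mul_le_mul_of_nonneg_left h₁.2.1 hd₁
  have := mul_le_mul_of_nonneg_left h₂.2.1 hd₂
  linarith

lemma InW.fPlus_le {x₁ x₂ y₁ y₂ Y₁₁ Y₁₂ Y₂₂ d₁ d₂ : ℝ} (h : InW x₁ x₂ y₁ y₂ Y₁₁ Y₁₂ Y₂₂)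
    (hd₁ : 0 ≤ d₁) (hd₂ : 0 ≤ d₂) (hd : 1 ≤ d₁ * d₂) :
    fPlus x₁ x₂ y₁ y₂ d₁ d₂ ≤ ENNReal.ofReal (d₁ * Y₁₁ + d₂ * Y₂₂ + 2 * Y₁₂) := by
  obtain ⟨W, rfl, h₁, h₂, hz₁, hz₂, hx, hW⟩ := h
  refine iInf_le_of_le (W 2 0) <| iInf_le_of_le (W 2 1) <| iInf_le_of_le (W 2 2) <|
    iInf_le_of_le ⟨hz₁.1, hz₂.1, max_le hW.diag_nonneg hx, le_min h₁.2.2 h₂.2.2⟩ ?_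
  have := quot_add_quot_add_quot_le hW h₁ h₂ hd₁ hd₂ hd (one_pow 2)
  simpa only [mul_one, ← mul_assoc] using this

lemma InW.fMinus_le {x₁ x₂ y₁ y₂ Y₁₁ Y₁₂ Y₂₂ d₁ d₂ : ℝ} (h : InW x₁ x₂ y₁ y₂ Y₁₁ Y₁₂ Y₂₂)
    (hd₁ : 0 ≤ d₁) (hd₂ : 0 ≤ d₂) (hd : 1 ≤ d₁ * d₂) :
    fMinus x₁ x₂ y₁ y₂ d₁ d₂ ≤ ENNReal.ofReal (d₁ * Y₁₁ + d₂ * Y₂₂ - 2 * Y₁₂) := by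
  obtain ⟨W, rfl, h₁, h₂, hz₁, hz₂, hx, hW⟩ := h
  refine iInf_le_of_le (W 2 0) <| iInf_le_of_le (W 2 1) <| iInf_le_of_le (W 2 2) <|
    iInf_le_of_le ⟨hz₁.2, hz₂.2, max_le hW.diag_nonneg hx, le_min h₁.2.2 h₂.2.2⟩ ?_
  have := quot_add_quot_add_quot_le (e := -1) hW h₁ h₂ hd₁ hd₂ hd (by norm_num)
  simpa only [mul_neg, mul_one, neg_mul, ← mul_assoc, ← sub_eq_add_neg] using this

/-- `ENNReal.ofReal` truncates negatives, hence `hc`, which `InW.form_nonneg` provides. -/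
lemma coe_sub_coe_nonpos {f : ℝ≥0∞} {c : ℝ} (hc : 0 ≤ c) (h : f ≤ ENNReal.ofReal c) :
    (f : EReal) - (c : EReal) ≤ 0 := by
  refine EReal.sub_nonpos.2 ?_
  have := EReal.coe_ennreal_le_coe_ennreal_iff.2 h
  rwa [EReal.coe_ennreal_ofReal, max_eq_left hc] at this

lemma InW.convex_comb {x₁ x₂ y₁ y₂ Y₁₁ Y₁₂ Y₂₂ x₁' x₂' y₁' y₂' Y₁₁' Y₁₂' Y₂₂' t s : ℝ}
    (h : InW x₁ x₂ y₁ y₂ Y₁₁ Y₁₂ Y₂₂) (h' : InW x₁' x₂' y₁' y₂' Y₁₁' Y₁₂' Y₂₂')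
    (ht : 0 ≤ t) (hs : 0 ≤ s) (hts : t + s = 1) :
    InW (t * x₁ + s * x₁') (t * x₂ + s * x₂') (t * y₁ + s * y₁') (t * y₂ + s * y₂')
      (t * Y₁₁ + s * Y₁₁') (t * Y₁₂ + s * Y₁₂') (t * Y₂₂ + s * Y₂₂') := by
  obtain ⟨W, rfl, ⟨p₁, q₁, r₁⟩, ⟨p₂, q₂, r₂⟩, ⟨z₁, w₁⟩, ⟨z₂, w₂⟩, hx, hW⟩ := h
  obtain ⟨W', rfl, ⟨p₁', q₁', r₁'⟩, ⟨p₂', q₂', r₂'⟩, ⟨z₁', w₁'⟩, ⟨z₂', w₂'⟩, hx', hW'⟩ := h'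
  refine ⟨t • W + s • W', rfl, ⟨?_, ?_, ?_⟩, ⟨?_, ?_, ?_⟩, ⟨?_, ?_⟩, ⟨?_, ?_⟩, ?_,
    (hW.smul ht).add (hW'.smul hs)⟩
  all_goals simp only [Matrix.add_apply, Matrix.smul_apply, smul_eq_mul]
  case refine_1 =>
    convert add_sq_le_add_mul_add (sub_nonneg.2 q₁) (sub_nonneg.2 r₁) (sub_nonneg.2 q₁')
      (sub_nonneg.2 r₁') ht hs p₁ p₁' using 1 <;> ring
  case refine_4 =>
    convert add_sq_le_add_mul_add (sub_nonneg.2 q₂) (sub_nonneg.2 r₂) (sub_nonneg.2 q₂')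
      (sub_nonneg.2 r₂') ht hs p₂ p₂' using 1 <;> ring
  case refine_11 =>
    have h₁ := mul_le_mul_of_nonneg_left hx ht
    have h₂ := mul_le_mul_of_nonneg_left hx' hs
    linarith
  all_goals first | positivity | gcongr

lemma convex_optPairsSet (n : ℕ) : Convex ℝ (optPairsSet n) := by
  rintro ⟨x, y, Y⟩ ⟨hY, hW, hb⟩ ⟨x', y', Y'⟩ ⟨hY', hW', hb'⟩ t s ht hs hts
  refine ⟨?_, fun i j hij => (hW i j hij).convex_comb (hW' i j hij) ht hs hts, fun i => ?_⟩
  -- For t + s = 1, replacing the outer product of the mean by the mean of the outer products leaves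
  -- the remainder ts(y - y')(y - y')'.
  · have h := ((hY.smul ht).add (hY'.smul hs)).add
      ((posSemidef_vecMulVec_self_star (y - y')).smul (mul_nonneg ht hs))
    convert h using 1
    ext i j
    obtain rfl : s = 1 - t := by linarith
    simp [vecMulVec_apply]
    ring
  · obtain ⟨h₁, h₂, h₃⟩ := hb i
    obtain ⟨h₁', h₂', h₃'⟩ := hb' i
    simp only at h₁ h₂ h₃ h₁' h₂' h₃'
    refine ⟨?_, ?_, ?_⟩
    · simp only [Prod.fst_add, Prod.smul_fst, Pi.add_apply, Pi.smul_apply, smul_eq_mul]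
      positivity
    · simp only [Prod.fst_add, Prod.smul_fst, Pi.add_apply, Pi.smul_apply, smul_eq_mul]
      nlinarith
    · simp only [Prod.fst_add, Prod.smul_fst, Prod.snd_add, Prod.smul_snd, Pi.add_apply,
        Pi.smul_apply, smul_eq_mul]
      positivity

lemma convexOn_optPairsObjective {n : ℕ} (a b : Fin n → ℝ) (Q : Matrix (Fin n) (Fin n) ℝ) :
    ConvexOn ℝ (optPairsSet n) (optPairsObjective a b Q) := by
  refine ⟨convex_optPairsSet n, fun p _ q _ t s _ _ _ => le_of_eq ?_⟩
  simp only [optPairsObjective, Prod.fst_add, Prod.snd_add, Prod.smul_fst, Prod.smul_snd,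
    dotProduct_add, dotProduct_smul, Matrix.add_apply, Matrix.smul_apply, smul_eq_mul, mul_add,
    Finset.sum_add_distrib, mul_left_comm _ t, mul_left_comm _ s, Finset.mul_sum]
  ring

lemma inW_of_indicator {x₁ x₂ y₁ y₂ : ℝ} (hx₁ : x₁ = 0 ∨ x₁ = 1) (hx₂ : x₂ = 0 ∨ x₂ = 1)
    (hy₁ : 0 ≤ y₁) (hy₂ : 0 ≤ y₂) (h₁ : y₁ * (1 - x₁) = 0) (h₂ : y₂ * (1 - x₂) = 0) :
    InW x₁ x₂ y₁ y₂ (y₁ * y₁) (y₁ * y₂) (y₂ * y₂) := by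
  have hl : 0 ≤ x₁ * x₂ := by rcases hx₁ with rfl | rfl <;> rcases hx₂ with rfl | rfl <;> norm_num
  -- If some xᵢ = 0 this matrix is zero, but then yᵢ = 0, so the entry y₁y₂ is still correct.
  refine ⟨(x₁ * x₂) • vecMulVec ![y₁, y₂, 1] (star ![y₁, y₂, 1]), ?_, ?_, ?_, ?_, ?_, ?_,
    (posSemidef_vecMulVec_self_star _).smul hl⟩
  all_goals
    rcases hx₁ with rfl | rfl <;> rcases hx₂ with rfl | rfl <;>
    simp_all [mul_self_nonneg, sq]

lemma vecMulVec_mem_optPairsSet {n : ℕ} {x y : Fin n → ℝ} (h : (x, y) ∈ indicatorSet n) :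
    (x, y, vecMulVec y y) ∈ optPairsSet n := by
  refine ⟨by simpa using PosSemidef.zero, fun i j _ => ?_, fun i => ?_⟩
  · obtain ⟨hxi, hyi, hi⟩ := h i
    obtain ⟨hxj, hyj, hj⟩ := h j
    exact inW_of_indicator hxi hxj hyi hyj hi hj
  · obtain ⟨hx, hy, -⟩ := h i
    refine ⟨?_, ?_, hy⟩ <;> rcases hx with hx | hx <;> simp only at hx ⊢ <;> rw [hx] <;> norm_num

lemma optPairsObjective_vecMulVec {n : ℕ} (a b : Fin n → ℝ) (Q : Matrix (Fin n) (Fin n) ℝ)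
    (x y : Fin n → ℝ) :
    optPairsObjective a b Q (x, y, vecMulVec y y) = objective a b Q (x, y) := by
  simp only [optPairsObjective, objective, vecMulVec_apply, dotProduct, mulVec, Finset.mul_sum]
  congr 1
  exact Finset.sum_congr rfl fun i _ => Finset.sum_congr rfl fun j _ => by ring

end QI

theorem mainTheorem4 (n : ℕ) (a b : Fin n → ℝ) (Q : Matrix (Fin n) (Fin n) ℝ)
    (hQ : Q.PosSemidef) :
    -- OptPairs is a convex problem
    Convex ℝ (QI.optPairsSet n) ∧
    ConvexOn ℝ (QI.optPairsSet n) (QI.optPairsObjective a b Q) ∧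
    -- every feasible point of (QI) lifts to OptPairs with the same objective value
    (∀ x y : Fin n → ℝ, (x, y) ∈ QI.indicatorSet n →
      (x, y, Matrix.vecMulVec y y) ∈ QI.optPairsSet n ∧
      QI.optPairsObjective a b Q (x, y, Matrix.vecMulVec y y) = QI.objective a b Q (x, y)) ∧
    -- the optimal value of OptPairs is a lower bound for that of (QI)
    (⨅ p ∈ QI.optPairsSet n, (QI.optPairsObjective a b Q p : EReal)) ≤
      (⨅ p ∈ QI.indicatorSet n, (QI.objective a b Q p : EReal)) ∧
    -- every feasible point of OptPairs satisfies the optimal pairwise inequalities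
    (∀ (x y : Fin n → ℝ) (Y : Matrix (Fin n) (Fin n) ℝ), (x, y, Y) ∈ QI.optPairsSet n →
      ∀ i j : Fin n, i < j →
        (⨆ d ∈ QI.coeffSet, ((QI.fPlus (x i) (x j) (y i) (y j) d.1 d.2 : EReal) -
          ((d.1 * Y i i + d.2 * Y j j + 2 * Y i j : ℝ) : EReal))) ≤ 0 ∧
        (⨆ d ∈ QI.coeffSet, ((QI.fMinus (x i) (x j) (y i) (y j) d.1 d.2 : EReal) -
          ((d.1 * Y i i + d.2 * Y j j - 2 * Y i j : ℝ) : EReal))) ≤ 0) := by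
  refine ⟨QI.convex_optPairsSet n, QI.convexOn_optPairsObjective a b Q, fun x y h =>
    ⟨QI.vecMulVec_mem_optPairsSet h, QI.optPairsObjective_vecMulVec a b Q x y⟩, ?_, ?_⟩
  · refine le_iInf₂ fun p hp => ?_
    obtain ⟨x, y⟩ := p
    refine iInf₂_le_of_le _ (QI.vecMulVec_mem_optPairsSet hp) ?_
    rw [QI.optPairsObjective_vecMulVec]
  · intro x y Y h i j hij
    have hW := h.2.1 i j hij
    simp only at hW
    refine ⟨iSup₂_le fun d hd => ?_, iSup₂_le fun d hd => ?_⟩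
    · refine QI.coe_sub_coe_nonpos ?_ (hW.fPlus_le hd.1 hd.2.1 hd.2.2)
      simpa using hW.form_nonneg (e := 1) hd.1 hd.2.1 hd.2.2 (by norm_num)
    · refine QI.coe_sub_coe_nonpos ?_ (hW.fMinus_le hd.1 hd.2.1 hd.2.2)
      simpa [sub_eq_add_neg] using hW.form_nonneg (e := -1) hd.1 hd.2.1 hd.2.2 (by norm_num)
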